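/- Let $\epsilon_0\ge 0$ and $\lambda\ge 2$. There is an integer $N$, depending only on $\epsilon_0$ and $\lambda$, such that for every $n\ge N$ every shuffled $\epsilon_0$-LDP adaptive process on $n$ records satisfies $\left(\lambda,\ \frac{2e^{\epsilon_0}\lambda}{n-1}\right)$-RDP. Here an $\epsilon_0$-LDP adaptive process on $n$ records from a domain $\mathcal D$ consists of measurable spaces $\mathcal S^{(1)},\dots,\mathcal S^{(n)}$ and of randomized algorithms $\mathcal R^{(i)}:\mathcal S^{(1)}\times\cdots\times\mathcal S^{(i-1)}\times\mathcal D\to\mathcal S^{(i)}$, $1\le i\le n$ (for each $x\in\mathcal D$, $\mathcal R^{(i)}(\cdot,x)$ is a Markov kernel), such that $$\mathbb P(\mathcal R^{(i)}(z_{1:i-1},x)\in E)\le e^{\epsilon_0}\,\mathbb P(\mathcal R^{(i)}(z_{1:i-1},x')\in E)$$ for all $i$, all $z_{1:i-1}$, all $x,x'\in\mathcal D$ and all measurable $E\subseteq \mathcal S^{(i)}$. On a dataset $(x_1,\dots,x_n)\in\mathcal D^n$ the shuffled process draws a uniformly random permutation $\pi$ of $\{1,\dots,n\}$, computes successively $z_i=\mathcal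 R^{(i)}(z_{1:i-1},x_{\pi(i)})$ for $i=1,\dots,n$, and outputs $z_{1:n}$. A mechanism $\mathcal M$ is $(\lambda,\epsilon)$-RDP if $D^\lambda(\mathcal M(X)\|\mathcal M(Y))\le\epsilon$ for all datasets $X,Y$ that differ in exactly one record, where for laws $U,V$ $$D^\lambda(U\|V)=\frac1{\lambda-1}\log \mathbb E_{x\sim V}\left[\left(\frac{dU}{dV}(x)\right)^{\lambda}\right],$$ with the value $+\infty$ if $U$ is not absolutely continuous with respect to $V$. -/

import Mathlib

open MeasureTheory ProbabilityTheory Filter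
open scoped ENNReal

noncomputable section

/-- The Rényi divergence of order `α` of `U` from `V`, as an extended real number:
`1 / (α - 1) * log E_{x ∼ V} [(dU/dV (x)) ^ α]` when `U ≪ V`, and `+∞` otherwise. -/
def renyiDivergence {Ω : Type*} [MeasurableSpace Ω] (α : ℝ) (U V : Measure Ω) : EReal :=
  open Classical in
  if U ≪ V then
    (((α - 1)⁻¹ : ℝ) : EReal) * ENNReal.log (∫⁻ ω, (U.rnDeriv V ω) ^ α ∂V)
  else ⊤

/-- Two datasets are neighbouring if they differ in exactly one record. -/
def Neighbouring {n : ℕ} {D : Type*} (X Y : Fin n → D) : Prop :=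
  ∃ i, X i ≠ Y i ∧ ∀ j, j ≠ i → X j = Y j

/-- `(α, ε)`-Rényi differential privacy of the mechanism on datasets of size `n`
which sends the dataset `X` to a random element of `Ω` with law `M X`. -/
def IsRDP {n : ℕ} {D Ω : Type*} [MeasurableSpace Ω] (α ε : ℝ)
    (M : (Fin n → D) → Measure Ω) : Prop :=
  ∀ X Y : Fin n → D, Neighbouring X Y → renyiDivergence α (M X) (M Y) ≤ (ε : EReal)

/-- `ε`-local differential privacy of the randomizer on single records
which sends the record `x` to a random element of `Ω` with law `M x`. -/
def IsLDP {D Ω : Type*} [MeasurableSpace Ω] (ε : ℝ) (M : D → Measure Ω) : Prop :=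
  ∀ (x y : D) (s : Set Ω), MeasurableSet s →
    M x s ≤ ENNReal.ofReal (Real.exp ε) * M y s

/-- An adaptive process on `n` records from `D` with range spaces `S 0, …, S (n - 1)`: for every
step `i` and every record `x`, a Markov kernel that turns the outputs of the steps before `i`
into the law of the output of step `i`. -/
structure AdaptiveProcess (n : ℕ) (D : Type*) (S : Fin n → Type*)
    [∀ i, MeasurableSpace (S i)] where
  /-- the randomizer of step `i` -/
  randomizer (i : Fin n) (x : D) :
    Kernel (∀ j : Fin i, S (j.castLE i.isLt.le)) (S i)
  isMarkov (i : Fin n) (x : D) : IsMarkovKernel (randomizer i x)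

namespace AdaptiveProcess

variable {n : ℕ} {D : Type*} {S : Fin n → Type*} [∀ i, MeasurableSpace (S i)]

/-- Every randomizer of the process is `ε`-LDP, for all values of the auxiliary inputs. -/
def IsLocallyDP (R : AdaptiveProcess n D S) (ε : ℝ) : Prop :=
  ∀ (i : Fin n) (z : ∀ j : Fin i, S (j.castLE i.isLt.le)),
    IsLDP ε (fun x => R.randomizer i x z)

/-- The joint law of the first `k` outputs when step `i` is run on the record `X i`. -/
def partialLaw (R : AdaptiveProcess n D S) (X : Fin n → D) :
    (k : ℕ) → (hk : k ≤ n) → Measure (∀ j : Fin k, S (j.castLE hk))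
  | 0, _ => Measure.dirac (fun j => j.elim0)
  | k + 1, hk =>
      (partialLaw R X k (Nat.le_of_succ_le hk) ⊗ₘ R.randomizer ⟨k, hk⟩ (X ⟨k, hk⟩)).map
        (fun p => Fin.snoc (α := fun j : Fin (k + 1) => S (j.castLE hk)) p.1 p.2)

/-- The law of the output `(z₁, …, zₙ)` of the adaptive process on the dataset `X`. -/
def law (R : AdaptiveProcess n D S) (X : Fin n → D) : Measure (∀ i, S i) :=
  R.partialLaw X n le_rfl

/-- The law of the output of the shuffled process on the dataset `X`: a permutation `π` is drawn
uniformly at random, and step `i` is run on the record `X (π i)`. -/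
def shuffledLaw (R : AdaptiveProcess n D S) (X : Fin n → D) : Measure (∀ i, S i) :=
  (Fintype.card (Equiv.Perm (Fin n)) : ℝ≥0∞)⁻¹ •
    ∑ π : Equiv.Perm (Fin n), R.law (fun i => X (π i))

end AdaptiveProcess

end

/-! Privacy comes from clones. Put `E = exp ε₀`, `c = (E - 1) / (E + 1)`, and let `a` be the record
where the datasets differ. At every step the randomizers of `X a` and `Y a` are mixtures of two
common kernels with weights `(1 ± c) / 2` and `(1 ∓ c) / 2`, and every other record uses these two
kernels, each equally often, with probability `1 / E` (`exists_clone_decomposition`). Call `a` and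
the records that do so marked, and call the choice of kernel a sign.

Since the order is uniform, marked records are exchangeable: the factor `1 ± c * sign` of `a` may be
averaged over all marked records (`sum_smul_cloneLaw_eq_average`). Both shuffled laws thus become
mixtures of the same laws, with weights proportional to `1 + u` and `1 - u`, where `u = c *
meanSign`. By Jensen, the Rényi moment is at most the mean of `(1 - u) * ((1 + u) / (1 - u)) ^ α`
under independent fair signs (`lintegral_rnDeriv_rpow_sum_le`).

This function lies below a quartic without cubic term (`exists_quartic_bound`). With `m` marked
records, `meanSign` has mean `0`, second moment `1 / m` and fourth moment at most `3 / m ^ 2`. As `m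
- 1` is binomial with parameters `n - 1` and `1 / E`, the means of `1 / m` and `1 / m ^ 2` are at
most `E / n` and `2 * (E / n) ^ 2`. The quadratic term stays strictly below `2 * α * (α - 1) * E /
n` because `c < 1`; for large `n` this gap absorbs the quartic term. -/

/-! ### Moments of likelihood ratios of mixtures -/

/-- Data processing for mixtures: if `Q` is a finite sum of finite measures and `P` reweights the
summands, then the moments of `dP/dQ` are at most those of the weights. -/
theorem lintegral_rnDeriv_rpow_sum_le {Ω ι : Type*} [MeasurableSpace Ω] [Fintype ι]
    (N : ι → Measure Ω) [∀ i, IsFiniteMeasure (N i)] (ρ : ι → ℝ≥0∞) {α : ℝ} (hα : 1 ≤ α) :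
    (∑ i, ρ i • N i) ≪ (∑ i, N i) ∧
      ∫⁻ ω, ((∑ i, ρ i • N i).rnDeriv (∑ i, N i) ω) ^ α ∂(∑ i, N i)
        ≤ ∑ i, ρ i ^ α * N i Set.univ := by
  classical
  set Q := ∑ i, N i with hQ
  have hle : ∀ i, N i ≤ Q := fun i => by
    rw [hQ, ← Finset.add_sum_erase _ _ (Finset.mem_univ i)]
    exact Measure.le_add_right le_rfl
  have hac : ∀ i, N i ≪ Q := fun i => (hle i).absolutelyContinuous
  set w : ι → Ω → ℝ≥0∞ := fun i => (N i).rnDeriv Q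
  have hw : ∀ i, Measurable (w i) := fun i => Measure.measurable_rnDeriv _ _
  have hN : ∀ i, Q.withDensity (w i) = N i := fun i => Measure.withDensity_rnDeriv_eq _ _ (hac i)
  have key : ∀ c : ι → ℝ≥0∞, ∑ i, c i • N i = Q.withDensity (fun ω => ∑ i, c i * w i ω) := by
    intro c
    ext s hs
    rw [withDensity_apply _ hs, lintegral_finsetSum _ fun i _ => (hw i).const_mul _]
    simp only [Measure.coe_finsetSum, Finset.sum_apply, Measure.smul_apply, smul_eq_mul]
    refine Finset.sum_congr rfl fun i _ => ?_
    rw [lintegral_const_mul _ (hw i), ← withDensity_apply _ hs, hN]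
  have hm : ∀ c : ι → ℝ≥0∞, Measurable (fun ω => ∑ i, c i * w i ω) := fun c =>
    Finset.measurable_fun_sum _ fun i _ => (hw i).const_mul _
  have hone : ∀ᵐ ω ∂Q, ∑ i, w i ω = 1 := by
    -- Unit coefficients in `key` reproduce `Q`, so the densities sum to `1` and serve as Jensen
    -- weights.
    have h1 : Q.withDensity (fun ω => ∑ i, 1 * w i ω) = Q := by
      rw [← key]; simp [hQ]
    have h2 := Measure.rnDeriv_withDensity Q (hm fun _ => 1)
    rw [h1] at h2
    filter_upwards [h2, Q.rnDeriv_self] with ω h3 h4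
    rw [h4] at h3
    simpa using h3.symm
  rw [key ρ]
  refine ⟨withDensity_absolutelyContinuous _ _, ?_⟩
  calc ∫⁻ ω, ((Q.withDensity fun ω => ∑ i, ρ i * w i ω).rnDeriv Q ω) ^ α ∂Q
      ≤ ∫⁻ ω, ∑ i, ρ i ^ α * w i ω ∂Q := by
        refine lintegral_mono_ae ?_
        filter_upwards [hone, Measure.rnDeriv_withDensity Q (hm ρ)] with ω h1 h2
        rw [h2]
        have := ENNReal.rpow_arith_mean_le_arith_mean_rpow Finset.univ (fun i => w i ω) ρ h1 hα
        simpa only [mul_comm] using this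
    _ = ∑ i, ρ i ^ α * N i Set.univ := by
        rw [lintegral_finsetSum _ fun i _ => (hw i).const_mul _]
        refine Finset.sum_congr rfl fun i _ => ?_
        rw [lintegral_const_mul _ (hw i), ← setLIntegral_univ, ← withDensity_apply _ .univ, hN]

theorem renyiDivergence_le_of_lintegral_le {Ω : Type*} [MeasurableSpace Ω] {α ε : ℝ} (hα : 1 < α)
    {U V : Measure Ω} (hac : U ≪ V)
    (h : ∫⁻ ω, (U.rnDeriv V ω) ^ α ∂V ≤ ENNReal.ofReal (Real.exp ((α - 1) * ε))) :
    renyiDivergence α U V ≤ (ε : EReal) := by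
  rw [renyiDivergence, if_pos hac]
  have h1 := ENNReal.log_monotone h
  rw [ENNReal.log_ofReal_of_pos (Real.exp_pos _), Real.log_exp] at h1
  have h0 : 0 < α - 1 := by linarith
  calc _ ≤ (((α - 1)⁻¹ : ℝ) : EReal) * (((α - 1) * ε : ℝ) : EReal) :=
        mul_le_mul_of_nonneg_left h1 (by exact_mod_cast (inv_pos.2 h0).le)
    _ = ε := by
        rw [← EReal.coe_mul, inv_mul_cancel_left₀ h0.ne']

/-! ### Clone decomposition of LDP randomizers -/

/-- A difference `A • κ - B • η` of Markov kernels with `A - B = 1` is again a Markov kernel if it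
is nonnegative. -/
theorem exists_isMarkovKernel_sub {Z S : Type*} [MeasurableSpace Z] [MeasurableSpace S]
    (κ η : Kernel Z S) [IsMarkovKernel κ] [IsMarkovKernel η] {A B : ℝ} (hA : 0 ≤ A) (hB : 0 ≤ B)
    (hAB : A - B = 1)
    (h : ∀ z s, MeasurableSet s → B * (η z).real s ≤ A * (κ z).real s) :
    ∃ ξ : Kernel Z S, IsMarkovKernel ξ ∧
      ∀ z s, MeasurableSet s → (ξ z).real s = A * (κ z).real s - B * (η z).real s := by
  have e : ∀ (C : ℝ) (μ : Measure S) [IsProbabilityMeasure μ] (s : Set S), 0 ≤ C →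
      (ENNReal.ofReal C • μ) s = ENNReal.ofReal (C * μ.real s) := by
    intro C μ _ s hC
    rw [ENNReal.ofReal_mul hC, ofReal_measureReal, Measure.smul_apply, smul_eq_mul]
  have hle : ∀ z, ENNReal.ofReal B • η z ≤ ENNReal.ofReal A • κ z := fun z => by
    refine Measure.le_iff.2 fun s hs => ?_
    rw [e _ _ _ hA, e _ _ _ hB]
    exact ENNReal.ofReal_le_ofReal (h z s hs)
  have hfin : ∀ z, IsFiniteMeasure (ENNReal.ofReal B • η z) := fun z =>
    Measure.smul_finite _ ENNReal.ofReal_ne_top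
  have hval : ∀ z s, MeasurableSet s → (ENNReal.ofReal A • κ z - ENNReal.ofReal B • η z) s =
      ENNReal.ofReal (A * (κ z).real s - B * (η z).real s) := fun z s hs => by
    rw [Measure.sub_apply hs (hle z), e _ _ _ hA, e _ _ _ hB, ENNReal.ofReal_sub _ (by positivity)]
  let ξ : Kernel Z S :=
    { toFun := fun z => ENNReal.ofReal A • κ z - ENNReal.ofReal B • η z
      measurable' := by
        refine Measure.measurable_of_measurable_coe _ fun s hs => ?_
        simp_rw [hval _ s hs]
        have h1 := (Kernel.measurable_coe κ hs).ennreal_toReal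
        have h2 := (Kernel.measurable_coe η hs).ennreal_toReal
        exact ((h1.const_mul A).sub (h2.const_mul B)).ennreal_ofReal }
  refine ⟨ξ, ⟨fun z => ⟨?_⟩⟩, fun z s hs => ?_⟩
  · change (ENNReal.ofReal A • κ z - ENNReal.ofReal B • η z) Set.univ = 1
    rw [hval z _ .univ]
    simp [hAB]
  · change ((ENNReal.ofReal A • κ z - ENNReal.ofReal B • η z) s).toReal = _
    rw [hval z s hs, ENNReal.toReal_ofReal]
    linarith [h z s hs]

/-- Decomposition of the `ε`-LDP randomizers: the randomizers of two records `a` and `b` are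
mixtures of two kernels `U`, `V`, and the randomizer of any record has a part of mass `exp (-ε)`
in which `U` and `V` are equally likely. -/
theorem exists_clone_decomposition {D Z S : Type*} [MeasurableSpace Z] [MeasurableSpace S]
    (κ : D → Kernel Z S) [∀ x, IsMarkovKernel (κ x)] {ε : ℝ} (hε : 0 ≤ ε)
    (h : ∀ z, IsLDP ε fun x => κ x z) (a b : D) :
    ∃ (G : Bool → Kernel Z S) (L : D → Kernel Z S),
      (∀ t, IsMarkovKernel (G t)) ∧ (∀ y, IsMarkovKernel (L y)) ∧
      ∀ z s, MeasurableSet s →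
        (κ a z).real s = 2⁻¹ * ((1 + (Real.exp ε - 1) / (Real.exp ε + 1)) * (G true z).real s
          + (1 - (Real.exp ε - 1) / (Real.exp ε + 1)) * (G false z).real s) ∧
        (κ b z).real s = 2⁻¹ * ((1 - (Real.exp ε - 1) / (Real.exp ε + 1)) * (G true z).real s
          + (1 + (Real.exp ε - 1) / (Real.exp ε + 1)) * (G false z).real s) ∧
        ∀ y, (κ y z).real s = (Real.exp ε)⁻¹ * 2⁻¹ * ((G true z).real s + (G false z).real s)
          + (1 - (Real.exp ε)⁻¹) * (L y z).real s := by
  set E := Real.exp ε with hE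
  have hE1 : 1 ≤ E := Real.one_le_exp hε
  have hldp : ∀ x y z s, MeasurableSet s → (κ x z).real s ≤ E * (κ y z).real s := by
    intro x y z s hs
    have := ENNReal.toReal_mono (by finiteness) (h z x y s hs)
    rwa [ENNReal.toReal_mul, ENNReal.toReal_ofReal (Real.exp_pos _).le] at this
  -- For `E = 1` the denominators `E - 1` vanish, but then all randomizers coincide and one kernel
  -- serves everywhere.
  rcases hE1.eq_or_lt with h1 | h1
  · have heq : ∀ x y z s, MeasurableSet s → (κ x z).real s = (κ y z).real s := by
      intro x y z s hs
      have h2 := hldp x y z s hs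
      have h3 := hldp y x z s hs
      rw [← h1] at h2 h3
      linarith
    refine ⟨fun _ => κ a, fun _ => κ a, fun _ => inferInstance, fun _ => inferInstance,
      fun z s hs => ⟨?_, ?_, fun y => ?_⟩⟩
    · ring
    · rw [heq b a z s hs]; ring
    · rw [heq y a z s hs]; ring
  · have hE0 : 0 < E - 1 := by linarith
    have hsub : ∀ x y, ∃ ξ : Kernel Z S, IsMarkovKernel ξ ∧ ∀ z s, MeasurableSet s →
        (ξ z).real s = E / (E - 1) * (κ x z).real s - 1 / (E - 1) * (κ y z).real s := fun x y =>
      exists_isMarkovKernel_sub (κ x) (κ y) (by positivity) (by positivity)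
        (by field_simp) fun z s hs => by
          have := hldp y x z s hs
          rw [div_mul_eq_mul_div, div_mul_eq_mul_div, one_mul]
          gcongr
    -- These solve `E * U + V = (E + 1) * κ a` and `U + E * V = (E + 1) * κ b`; LDP is exactly their
    -- nonnegativity. Since `U + V = κ a + κ b`, the common part can be subtracted from any `κ y`.
    obtain ⟨U, hU, hU'⟩ := hsub a b
    obtain ⟨V, hV, hV'⟩ := hsub b a
    have hrest : ∀ y, ∃ ξ : Kernel Z S, IsMarkovKernel ξ ∧ ∀ z s, MeasurableSet s →
        (ξ z).real s = E / (E - 1) * (κ y z).real s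
          - 1 / (E - 1) * (2⁻¹ * ((κ a z).real s + (κ b z).real s)) := fun y => by
      obtain ⟨η, hη, hη'⟩ : ∃ η : Kernel Z S, IsMarkovKernel η ∧ ∀ z s, MeasurableSet s →
          (η z).real s = 2⁻¹ * ((κ a z).real s + (κ b z).real s) := by
        let η : Kernel Z S :=
          { toFun := fun z => (2⁻¹ : ℝ≥0∞) • (κ a z + κ b z)
            measurable' := by
              refine Measure.measurable_of_measurable_coe _ fun s hs => ?_
              exact (((Kernel.measurable_coe (κ a) hs).add
                (Kernel.measurable_coe (κ b) hs)).const_mul 2⁻¹) }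
        refine ⟨η, ⟨fun z => ⟨?_⟩⟩, fun z s hs => ?_⟩
        · change (2⁻¹ : ℝ≥0∞) * (κ a z Set.univ + κ b z Set.univ) = 1
          simp only [measure_univ, one_add_one_eq_two]
          exact ENNReal.inv_mul_cancel (by simp) (by simp)
        · change ((2⁻¹ : ℝ≥0∞) * (κ a z s + κ b z s)).toReal = _
          rw [ENNReal.toReal_mul, ENNReal.toReal_add (by finiteness) (by finiteness)]
          simp [Measure.real]
      obtain ⟨ξ, hξ, hξ'⟩ := exists_isMarkovKernel_sub (κ y) η (A := E / (E - 1))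
        (B := 1 / (E - 1)) (by positivity) (by positivity) (by field_simp) fun z s hs => by
          have h2 := hldp a y z s hs
          have h3 := hldp b y z s hs
          rw [hη' z s hs, div_mul_eq_mul_div, div_mul_eq_mul_div, one_mul]
          exact div_le_div_of_nonneg_right (by linarith) hE0.le
      exact ⟨ξ, hξ, fun z s hs => by rw [hξ' z s hs, hη' z s hs]⟩
    choose L hL hL' using hrest
    refine ⟨fun t => if t then U else V, L, fun t => by cases t <;> simpa, hL,
      fun z s hs => ⟨?_, ?_, fun y => ?_⟩⟩
    all_goals
      simp only [if_true, Bool.false_eq_true, if_false, hU' z s hs, hV' z s hs, hL' _ z s hs]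
      field_simp
      ring

/-! ### Multilinearity of the law of a chain -/

noncomputable section

section Chain

variable {n : ℕ} {S : Fin n → Type*} [∀ i, MeasurableSpace (S i)]

/-- The joint law of the first `k` coordinates of the chain with transition kernels `K`. -/
def chainLaw (K : ∀ i : Fin n, Kernel (∀ j : Fin i, S (j.castLE i.isLt.le)) (S i)) :
    (k : ℕ) → (hk : k ≤ n) → Measure (∀ j : Fin k, S (j.castLE hk))
  | 0, _ => Measure.dirac (fun j => j.elim0)
  | k + 1, hk =>
      (chainLaw K k (Nat.le_of_succ_le hk) ⊗ₘ K ⟨k, hk⟩).map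
        (fun p => Fin.snoc (α := fun j : Fin (k + 1) => S (j.castLE hk)) p.1 p.2)

theorem AdaptiveProcess.partialLaw_eq_chainLaw {D : Type*} (R : AdaptiveProcess n D S)
    (X : Fin n → D) (k : ℕ) (hk : k ≤ n) :
    R.partialLaw X k hk = chainLaw (fun i => R.randomizer i (X i)) k hk := by
  induction k with
  | zero => rfl
  | succ k ih => rw [AdaptiveProcess.partialLaw, chainLaw, ih]

theorem measurable_snoc_castLE {k : ℕ} (hk : k + 1 ≤ n) :
    Measurable (fun p : (∀ j : Fin k, S (j.castLE (Nat.le_of_succ_le hk))) × S ⟨k, hk⟩ =>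
      Fin.snoc (α := fun j : Fin (k + 1) => S (j.castLE hk)) p.1 p.2) := by
  refine measurable_pi_lambda _ fun j => ?_
  refine Fin.lastCases ?_ (fun j => ?_) j
  · simp only [Fin.snoc_last]
    exact measurable_snd
  · simp only [Fin.snoc_castSucc]
    exact (measurable_pi_apply j).comp measurable_fst

theorem isProbabilityMeasure_chainLaw
    (K : ∀ i : Fin n, Kernel (∀ j : Fin i, S (j.castLE i.isLt.le)) (S i))
    [∀ i, IsMarkovKernel (K i)] (k : ℕ) (hk : k ≤ n) : IsProbabilityMeasure (chainLaw K k hk) := by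
  induction k with
  | zero => rw [chainLaw]; infer_instance
  | succ k ih =>
    rw [chainLaw]
    have := ih (Nat.le_of_succ_le hk)
    exact Measure.isProbabilityMeasure_map (measurable_snoc_castLE hk).aemeasurable

theorem chainLaw_congr {K K' : ∀ i : Fin n, Kernel (∀ j : Fin i, S (j.castLE i.isLt.le)) (S i)}
    (k : ℕ) (hk : k ≤ n) (h : ∀ i : Fin n, (i : ℕ) < k → K i = K' i) :
    chainLaw K k hk = chainLaw K' k hk := by
  induction k with
  | zero => rfl
  | succ k ih =>
    rw [chainLaw, chainLaw, ih _ fun i hi => h i (by omega), h ⟨k, hk⟩ (by simp)]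

theorem MeasureTheory.Measure.compProd_sum_smul {Z W ι Λ : Type*} [MeasurableSpace Z]
    [MeasurableSpace W] [Fintype ι] [Fintype Λ] (c : ι → ℝ≥0∞) (μ : ι → Measure Z)
    [∀ i, IsFiniteMeasure (μ i)] (w : Λ → ℝ≥0∞) (g : Λ → Kernel Z W) [∀ l, IsMarkovKernel (g l)]
    (κ : Kernel Z W) [IsMarkovKernel κ] (h : ∀ z, κ z = ∑ l, w l • g l z) :
    (∑ i, c i • μ i) ⊗ₘ κ = ∑ i, ∑ l, (c i * w l) • (μ i ⊗ₘ g l) := by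
  have : SFinite (∑ i, c i • μ i) := by
    rw [← Measure.sum_fintype]; infer_instance
  ext s hs
  rw [Measure.compProd_apply hs, lintegral_finsetSum_measure]
  simp only [Measure.coe_finsetSum, Finset.sum_apply, Measure.smul_apply, smul_eq_mul, h,
    Measure.compProd_apply hs, lintegral_smul_measure]
  refine Finset.sum_congr rfl fun i _ => ?_
  rw [lintegral_finsetSum _ fun l _ => (Kernel.measurable_kernel_prodMk_left hs).const_mul _,
    Finset.mul_sum]
  refine Finset.sum_congr rfl fun l _ => ?_
  rw [lintegral_const_mul _ (Kernel.measurable_kernel_prodMk_left hs), mul_assoc]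

/-- The law of a chain is multilinear in the transition kernels. -/
theorem chainLaw_sum_smul {Λ : Type*} [Fintype Λ] [Nonempty Λ]
    (K : ∀ i : Fin n, Kernel (∀ j : Fin i, S (j.castLE i.isLt.le)) (S i))
    [∀ i, IsMarkovKernel (K i)]
    (G : ∀ i : Fin n, Λ → Kernel (∀ j : Fin i, S (j.castLE i.isLt.le)) (S i))
    [∀ i l, IsMarkovKernel (G i l)] (w : Fin n → Λ → ℝ≥0∞)
    (h : ∀ i z, K i z = ∑ l, w i l • G i l z) (k : ℕ) (hk : k ≤ n) :
    chainLaw K k hk = ∑ τ : Fin k → Λ, (∏ i, w (i.castLE hk) (τ i)) •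
      chainLaw (fun i => G i (if hi : (i : ℕ) < k then τ ⟨i, hi⟩ else Classical.arbitrary Λ))
        k hk := by
  induction k with
  | zero => simp [chainLaw]
  | succ k ih =>
    have := fun τ : Fin k → Λ => isProbabilityMeasure_chainLaw
      (fun i => G i (if hi : (i : ℕ) < k then τ ⟨i, hi⟩ else Classical.arbitrary Λ)) k
      (Nat.le_of_succ_le hk)
    rw [chainLaw, ih (Nat.le_of_succ_le hk),
      Measure.compProd_sum_smul _ _ (w ⟨k, hk⟩) (G ⟨k, hk⟩) _ (h ⟨k, hk⟩)]
    have hm := measurable_snoc_castLE (S := S) hk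
    rw [← Fintype.sum_prod_type', Measure.map_finset_sum hm.aemeasurable]
    refine Fintype.sum_equiv ((Equiv.prodComm _ _).trans (Fin.snocEquiv fun _ => Λ)) _ _ ?_
    rintro ⟨τ, l⟩
    rw [Measure.map_smul, chainLaw, Fin.prod_univ_castSucc]
    simp only [Equiv.trans_apply, Equiv.prodComm_apply, Prod.swap_prod_mk, Fin.snocEquiv_apply,
      Fin.snoc_castSucc, Fin.snoc_last]
    congr 2
    -- The first `k` steps read neither the label appended at `k` nor the arbitrary default.
    have h1 : chainLaw (fun i => G i (if hi : (i : ℕ) < k + 1 then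
        (Fin.snoc (α := fun _ => Λ) τ l : Fin (k + 1) → Λ) ⟨i, hi⟩
          else Classical.arbitrary Λ)) k (Nat.le_of_succ_le hk) =
        chainLaw (fun i => G i (if hi : (i : ℕ) < k then τ ⟨i, hi⟩ else Classical.arbitrary Λ)) k
          (Nat.le_of_succ_le hk) := by
      refine chainLaw_congr _ _ fun i hi => ?_
      rw [dif_pos (Nat.lt_succ_of_lt hi), dif_pos hi]
      congr 1
      exact Fin.snoc_castSucc (α := fun _ => Λ) l τ ⟨i, hi⟩
    rw [h1]
    congr 2
    rw [dif_pos (Nat.lt_succ_self k)]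
    exact (Fin.snoc_last (α := fun _ => Λ) l τ).symm

end Chain
end

/-! ### Exchangeability of the marked records -/

noncomputable section

section Shuffle

variable {n : ℕ} {D : Type*} {S : Fin n → Type*} [∀ i, MeasurableSpace (S i)]

/-- The law of the chain whose step `i` serves the record `π i` by the kernel `G i (s (π i))` if
that record is marked by `T` and by `L i (π i)` otherwise. -/
def cloneLaw (G : ∀ i : Fin n, Bool → Kernel (∀ j : Fin i, S (j.castLE i.isLt.le)) (S i))
    (L : ∀ i : Fin n, Fin n → Kernel (∀ j : Fin i, S (j.castLE i.isLt.le)) (S i))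
    (π : Equiv.Perm (Fin n)) (T s : Fin n → Bool) : Measure (∀ i, S i) :=
  chainLaw (fun i => if T (π i) then G i (s (π i)) else L i (π i)) n le_rfl

variable (G : ∀ i : Fin n, Bool → Kernel (∀ j : Fin i, S (j.castLE i.isLt.le)) (S i))
  (L : ∀ i : Fin n, Fin n → Kernel (∀ j : Fin i, S (j.castLE i.isLt.le)) (S i))

theorem isProbabilityMeasure_cloneLaw [∀ i t, IsMarkovKernel (G i t)]
    [∀ i j, IsMarkovKernel (L i j)] (π : Equiv.Perm (Fin n)) (T s : Fin n → Bool) :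
    IsProbabilityMeasure (cloneLaw G L π T s) := by
  have : ∀ i, IsMarkovKernel (if T (π i) then G i (s (π i)) else L i (π i)) := fun i => by
    split_ifs <;> infer_instance
  exact isProbabilityMeasure_chainLaw _ n le_rfl

theorem chainLaw_eq_sum_smul {Λ : Type*} [Fintype Λ] [Nonempty Λ]
    (K : ∀ i : Fin n, Kernel (∀ j : Fin i, S (j.castLE i.isLt.le)) (S i))
    [∀ i, IsMarkovKernel (K i)]
    (G : ∀ i : Fin n, Λ → Kernel (∀ j : Fin i, S (j.castLE i.isLt.le)) (S i))
    [∀ i l, IsMarkovKernel (G i l)] (w : Fin n → Λ → ℝ≥0∞)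
    (h : ∀ i z, K i z = ∑ l, w i l • G i l z) :
    chainLaw K n le_rfl = ∑ τ : Fin n → Λ, (∏ i, w i (τ i)) •
      chainLaw (fun i => G i (τ i)) n le_rfl := by
  rw [chainLaw_sum_smul K G w h n le_rfl]
  refine Finset.sum_congr rfl fun τ _ => ?_
  congr 1
  exact chainLaw_congr _ _ fun i hi => by rw [dif_pos hi]

/-- Multilinearity labels the steps; transport along `π` moves the labels to the records, which
makes the weights independent of `π`. -/
theorem AdaptiveProcess.shuffledLaw_eq_sum_cloneLaw [∀ i t, IsMarkovKernel (G i t)]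
    [∀ i j, IsMarkovKernel (L i j)] (R : AdaptiveProcess n D S) (X : Fin n → D) (a : Fin n)
    (q : Fin n → Bool → ℝ≥0∞) (h : Bool → ℝ≥0∞)
    (hR : ∀ i j z, R.randomizer i (X j) z = ∑ t : Bool × Bool,
      (q j t.1 * 2⁻¹ * (if j = a then h t.2 else 1)) • (if t.1 then G i t.2 else L i j) z) :
    R.shuffledLaw X = ∑ T : Fin n → Bool, ((n.factorial : ℝ≥0∞)⁻¹ * (∏ j, q j (T j)) * 2⁻¹ ^ n) •
      ∑ π : Equiv.Perm (Fin n), ∑ s : Fin n → Bool, h (s a) • cloneLaw G L π T s := by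
  have hM := R.isMarkov
  have hπ : ∀ π : Equiv.Perm (Fin n), R.law (fun i => X (π i)) = ∑ T : Fin n → Bool,
      ∑ s : Fin n → Bool, ((∏ j, q j (T j)) * 2⁻¹ ^ n * h (s a)) • cloneLaw G L π T s := by
    intro π
    have : ∀ (i : Fin n) (t : Bool × Bool),
        IsMarkovKernel (if t.1 then G i t.2 else L i (π i)) := fun i t => by
      split_ifs <;> infer_instance
    rw [AdaptiveProcess.law, AdaptiveProcess.partialLaw_eq_chainLaw,
      chainLaw_eq_sum_smul _ (fun i (t : Bool × Bool) => if t.1 then G i t.2 else L i (π i)) _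
        (fun i z => hR i (π i) z), ← Fintype.sum_prod_type']
    refine Fintype.sum_equiv ((π.arrowCongr (Equiv.refl (Bool × Bool))).trans
      (Equiv.arrowProdEquivProdArrow _ _ _)) _ _ fun τ => ?_
    congr 1
    · rw [← Equiv.prod_comp π (fun j => q j _)]
      simp only [Finset.prod_mul_distrib, Finset.prod_const, Finset.card_univ, Fintype.card_fin,
        Equiv.trans_apply, Equiv.arrowProdEquivProdArrow_apply, Equiv.arrowCongr_apply,
        Equiv.coe_refl, Function.comp_apply, id, Equiv.symm_apply_apply]
      congr 1
      have := Finset.prod_ite_eq' Finset.univ (π.symm a) fun i => h (τ i).2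
      simpa [Equiv.eq_symm_apply] using this
    · simp [cloneLaw, Equiv.arrowCongr_apply]
  rw [AdaptiveProcess.shuffledLaw]
  simp_rw [hπ]
  rw [Fintype.card_perm, Fintype.card_fin, Finset.sum_comm, Finset.smul_sum]
  refine Finset.sum_congr rfl fun T _ => ?_
  simp only [Finset.smul_sum, smul_smul]
  refine Finset.sum_congr rfl fun π _ => Finset.sum_congr rfl fun s _ => ?_
  congr 1
  ring

/-- A marked record enters its step only through its sign, so two marked records can trade places if
they also trade signs. -/
theorem cloneLaw_swap (π : Equiv.Perm (Fin n)) (T s : Fin n → Bool) {a j : Fin n} (ha : T a)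
    (hj : T j) :
    cloneLaw G L (Equiv.swap a j * π) T (s ∘ Equiv.swap a j) = cloneLaw G L π T s := by
  rw [cloneLaw, cloneLaw]
  congr 1
  funext i
  simp only [Equiv.Perm.mul_apply, Function.comp_apply, Equiv.swap_apply_self]
  rcases eq_or_ne (π i) a with h | h
  · simp [h, ha, hj]
  rcases eq_or_ne (π i) j with h' | h'
  · simp [h', ha, hj]
  · rw [Equiv.swap_apply_of_ne_of_ne h h']

/-- Among the marked records, a function of the sign of one record can be replaced by its average. -/
theorem sum_smul_cloneLaw_eq_average (T : Fin n → Bool) {a : Fin n} (ha : T a) (h : Bool → ℝ≥0∞) :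
    ∑ π : Equiv.Perm (Fin n), ∑ s : Fin n → Bool, h (s a) • cloneLaw G L π T s =
      ∑ π : Equiv.Perm (Fin n), ∑ s : Fin n → Bool,
        (((Finset.univ.filter fun j => T j).card : ℝ≥0∞)⁻¹ *
          ∑ j with T j, h (s j)) • cloneLaw G L π T s := by
  have hswap : ∀ j, T j → ∑ π : Equiv.Perm (Fin n), ∑ s : Fin n → Bool,
      h (s j) • cloneLaw G L π T s =
        ∑ π : Equiv.Perm (Fin n), ∑ s : Fin n → Bool, h (s a) • cloneLaw G L π T s := by
    intro j hj
    refine Fintype.sum_equiv (Equiv.mulLeft (Equiv.swap a j)) _ _ fun π => ?_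
    refine Fintype.sum_equiv ((Equiv.swap a j).arrowCongr (Equiv.refl Bool)) _ _ fun s => ?_
    have := cloneLaw_swap G L π T s ha hj
    have hs : (Equiv.swap a j).arrowCongr (Equiv.refl Bool) s = s ∘ Equiv.swap a j := by
      ext i; simp [Equiv.arrowCongr_apply]
    rw [hs, Equiv.coe_mulLeft, this, Function.comp_apply, Equiv.swap_apply_left]
  have hcard : ((Finset.univ.filter fun j => T j).card : ℝ≥0∞) ≠ 0 := by
    simpa [Finset.filter_eq_empty_iff] using ⟨a, ha⟩
  have hsum := Finset.sum_congr (rfl : (Finset.univ.filter fun j => T j) = _)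
    fun j hj => hswap j (Finset.mem_filter.1 hj).2
  rw [Finset.sum_const, ← Nat.cast_smul_eq_nsmul ℝ≥0∞] at hsum
  calc _ = ((Finset.univ.filter fun j => T j).card : ℝ≥0∞)⁻¹ •
        ((Finset.univ.filter fun j => T j).card : ℝ≥0∞) •
          ∑ π : Equiv.Perm (Fin n), ∑ s : Fin n → Bool, h (s a) • cloneLaw G L π T s := by
        rw [smul_smul, ENNReal.inv_mul_cancel hcard (by finiteness), one_smul]
    _ = _ := by
        rw [← hsum, Finset.sum_comm, Finset.smul_sum]
        refine Finset.sum_congr rfl fun π _ => ?_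
        rw [Finset.sum_comm, Finset.smul_sum]
        refine Finset.sum_congr rfl fun s _ => ?_
        rw [← Finset.sum_smul, smul_smul]

end Shuffle
end

/-! ### Moments of sums of independent signs -/

/-- The sign `1` or `-1` of a bit. -/
def boolSign (b : Bool) : ℝ := if b then 1 else -1

theorem boolSign_not (b : Bool) : boolSign (!b) = -boolSign b := by cases b <;> simp [boolSign]

theorem abs_sum_boolSign_le {ι : Type*} (A : Finset ι) (s : ι → Bool) :
    |∑ j ∈ A, boolSign (s j)| ≤ A.card := by
  refine (Finset.abs_sum_le_sum_abs _ _).trans ?_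
  rw [← nsmul_one, ← Finset.sum_const]
  refine Finset.sum_le_sum fun j _ => ?_
  cases s j <;> simp [boolSign]

section SignMoments

variable {ι : Type*} [Fintype ι] [DecidableEq ι]

/-- Pairs each `s` with its flip at `a`. For `F` a power this is a recursion for the moments in the
size of `A`. -/
theorem two_mul_sum_insert_boolSign (F : ℝ → ℝ) (A : Finset ι) {a : ι} (ha : a ∉ A) :
    2 * ∑ s : ι → Bool, F (∑ j ∈ insert a A, boolSign (s j)) =
      ∑ s : ι → Bool, (F (∑ j ∈ A, boolSign (s j) + 1) + F (∑ j ∈ A, boolSign (s j) - 1)) := by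
  have hinv : Function.Involutive fun s : ι → Bool => Function.update s a (!s a) := fun s => by
    simp
  have h1 : ∑ s : ι → Bool, F (∑ j ∈ insert a A, boolSign (s j)) =
      ∑ s : ι → Bool, F (∑ j ∈ A, boolSign (s j) - boolSign (s a)) := by
    refine Fintype.sum_equiv hinv.toPerm _ _ fun s => ?_
    have : ∀ j ∈ A, boolSign (Function.update s a (!s a) j) = boolSign (s j) := fun j hj => by
      rw [Function.update_of_ne (by rintro rfl; exact ha hj)]
    simp only [Function.Involutive.coe_toPerm, Finset.sum_congr rfl this, Function.update_self,
      boolSign_not, sub_neg_eq_add, Finset.sum_insert ha]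
    rw [add_comm]
  rw [two_mul]
  nth_rw 2 [h1]
  rw [← Finset.sum_add_distrib]
  refine Finset.sum_congr rfl fun s _ => ?_
  rw [Finset.sum_insert ha]
  cases s a
  · simp only [boolSign, Bool.false_eq_true, if_false, sub_neg_eq_add]
    rw [add_comm (F _), neg_add_eq_sub]
  · simp only [boolSign, if_true]
    rw [add_comm 1]

theorem sum_sum_boolSign (A : Finset ι) :
    ∑ s : ι → Bool, ∑ j ∈ A, boolSign (s j) = 0 := by
  induction A using Finset.induction_on with
  | empty => simp
  | insert a A ha ih =>
    have h := two_mul_sum_insert_boolSign (fun x => x) A ha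
    simp only [add_add_sub_cancel, ← two_mul, ← Finset.mul_sum] at h
    linarith

theorem sum_sum_boolSign_sq (A : Finset ι) :
    ∑ s : ι → Bool, (∑ j ∈ A, boolSign (s j)) ^ 2 = 2 ^ Fintype.card ι * A.card := by
  induction A using Finset.induction_on with
  | empty => simp
  | insert a A ha ih =>
    have h := two_mul_sum_insert_boolSign (fun x => x ^ 2) A ha
    have h2 : ∀ x : ℝ, (x + 1) ^ 2 + (x - 1) ^ 2 = 2 * x ^ 2 + 2 := fun x => by ring
    simp only [h2, Finset.sum_add_distrib, ← Finset.mul_sum, ih] at h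
    simp only [Finset.sum_const, Finset.card_univ, Fintype.card_fun, Fintype.card_bool,
      nsmul_eq_mul, Nat.cast_pow, Nat.cast_ofNat] at h
    rw [Finset.card_insert_of_notMem ha]
    push_cast
    linarith

theorem sum_sum_boolSign_pow_four_le (A : Finset ι) :
    ∑ s : ι → Bool, (∑ j ∈ A, boolSign (s j)) ^ 4 ≤ 2 ^ Fintype.card ι * (3 * A.card ^ 2) := by
  induction A using Finset.induction_on with
  | empty => simp
  | insert a A ha ih =>
    have h := two_mul_sum_insert_boolSign (fun x => x ^ 4) A ha
    have h2 : ∀ x : ℝ, (x + 1) ^ 4 + (x - 1) ^ 4 = 2 * x ^ 4 + 12 * x ^ 2 + 2 := fun x => by ring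
    simp only [h2, Finset.sum_add_distrib, ← Finset.mul_sum, sum_sum_boolSign_sq] at h
    simp only [Finset.sum_const, Finset.card_univ, Fintype.card_fun, Fintype.card_bool,
      nsmul_eq_mul, Nat.cast_pow, Nat.cast_ofNat] at h
    rw [Finset.card_insert_of_notMem ha]
    push_cast
    have : (0 : ℝ) < 2 ^ Fintype.card ι := by positivity
    nlinarith

end SignMoments

/-! ### Inverse moments of a shifted binomial variable -/

section BinomialMoments

open Finset

/-- Absorbing `k + 1` into `(N + 1).choose (k + 1)` leaves a binomial sum for `N + 1` without its
zeroth term. -/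
theorem sum_choose_mul_inv_succ_le {r : ℝ} (hr : 0 < r) (hr1 : r ≤ 1) (N : ℕ) :
    ∑ k ∈ range (N + 1), (N.choose k : ℝ) * (r ^ k * (1 - r) ^ (N - k) * ((k : ℝ) + 1)⁻¹) ≤
      ((N + 1) * r)⁻¹ := by
  have h1 : (∑ k ∈ range (N + 2), r ^ k * (1 - r) ^ (N + 1 - k) * ((N + 1).choose k : ℝ)) = 1 := by
    rw [← add_pow]; simp
  rw [sum_range_succ'] at h1
  have h2 : ∀ k ∈ range (N + 1),
      (N.choose k : ℝ) * (r ^ k * (1 - r) ^ (N - k) * ((k : ℝ) + 1)⁻¹) =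
      ((N + 1) * r)⁻¹ * (r ^ (k + 1) * (1 - r) ^ (N + 1 - (k + 1)) * ((N + 1).choose (k + 1) : ℝ)) := by
    intro k _
    have := Nat.add_one_mul_choose_eq N k
    have h3 : ((N : ℝ) + 1) * N.choose k = (N + 1).choose (k + 1) * (k + 1) := by exact_mod_cast this
    rw [Nat.add_sub_add_right, pow_succ]
    field_simp
    linear_combination (1 - r) ^ (N - k) * h3
  rw [sum_congr rfl h2, ← mul_sum]
  refine mul_le_of_le_one_right (by positivity) ?_
  have : 0 ≤ r ^ 0 * (1 - r) ^ (N + 1 - 0) * ((N + 1).choose 0 : ℝ) := by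
    have := sub_nonneg.2 hr1
    positivity
  linarith

/-- Since `1 / (k + 1) ^ 2 ≤ 2 / ((k + 1) * (k + 2))`, one absorption reduces to the first inverse
moment at `N + 1`. -/
theorem sum_choose_mul_inv_succ_sq_le {r : ℝ} (hr : 0 < r) (hr1 : r ≤ 1) (N : ℕ) :
    ∑ k ∈ range (N + 1), (N.choose k : ℝ) * (r ^ k * (1 - r) ^ (N - k) * (((k : ℝ) + 1) ^ 2)⁻¹) ≤
      2 * (((N + 1) * r)⁻¹) ^ 2 := by
  have h0 := sub_nonneg.2 hr1
  have h1 := sum_choose_mul_inv_succ_le hr hr1 (N + 1)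
  rw [sum_range_succ'] at h1
  have h2 : ∀ k ∈ range (N + 1),
      (N.choose k : ℝ) * (r ^ k * (1 - r) ^ (N - k) * (((k : ℝ) + 1) ^ 2)⁻¹) ≤
      2 * ((N + 1) * r)⁻¹ * (((N + 1).choose (k + 1) : ℝ) *
        (r ^ (k + 1) * (1 - r) ^ (N + 1 - (k + 1)) * (((k + 1 : ℕ) : ℝ) + 1)⁻¹)) := by
    intro k _
    have := Nat.add_one_mul_choose_eq N k
    have h3 : ((N + 1).choose (k + 1) : ℝ) = ((N : ℝ) + 1) * N.choose k / (k + 1) := by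
      rw [eq_div_iff (by positivity)]; exact_mod_cast this.symm
    rw [h3, Nat.add_sub_add_right, pow_succ r k]
    have h4 : (((k : ℝ) + 1) ^ 2)⁻¹ ≤ 2 * (((k : ℝ) + 1)⁻¹ * (((k : ℝ) + 1) + 1)⁻¹) := by
      rw [← mul_inv, ← div_eq_mul_inv, inv_le_comm₀ (by positivity) (by positivity), inv_div,
        div_le_iff₀ two_pos]
      nlinarith [(k.cast_nonneg : (0 : ℝ) ≤ k)]
    calc _ ≤ (N.choose k : ℝ) * (r ^ k * (1 - r) ^ (N - k) *
          (2 * (((k : ℝ) + 1)⁻¹ * (((k : ℝ) + 1) + 1)⁻¹))) := by gcongr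
      _ = _ := by push_cast; field_simp
  refine (sum_le_sum h2).trans ?_
  rw [← mul_sum]
  have h5 : 0 ≤ (((N + 1).choose 0 : ℕ) : ℝ) *
      (r ^ 0 * (1 - r) ^ (N + 1 - 0) * (((0 : ℕ) : ℝ) + 1)⁻¹) := by positivity
  have h6 : (((N + 1 : ℕ) : ℝ) + 1) * r ≥ (N + 1) * r := by push_cast; gcongr; linarith
  have h7 : ((((N + 1 : ℕ) : ℝ) + 1) * r)⁻¹ ≤ ((N + 1) * r)⁻¹ := inv_anti₀ (by positivity) h6
  rw [pow_two, ← mul_assoc]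
  refine mul_le_mul_of_nonneg_left ?_ (by positivity)
  linarith

/-- Sums over the marked sets that contain `a`, where the other elements are marked independently
with probability `r`. -/
theorem sum_prod_mark_eq {n : ℕ} (a : Fin (n + 1)) (r : ℝ) (φ : ℕ → ℝ) :
    ∑ T : Fin (n + 1) → Bool, (∏ j, (if j = a then (if T j then 1 else 0)
        else (if T j then r else 1 - r))) * φ (univ.filter fun j => T j).card =
      ∑ k ∈ range (n + 1), (n.choose k : ℝ) * (r ^ k * (1 - r) ^ (n - k) * φ (k + 1)) := by
  let e : (Fin (n + 1) → Bool) ≃ Finset (Fin (n + 1)) :=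
    { toFun := fun T => univ.filter fun j => T j
      invFun := fun A j => decide (j ∈ A)
      left_inv := fun T => by ext j; simp
      right_inv := fun A => by ext j; simp }
  have h1 := Fintype.sum_equiv e (fun T => (∏ j, (if j = a then (if T j then (1 : ℝ) else 0)
        else (if T j then r else 1 - r))) * φ (univ.filter fun j => T j).card)
      (fun A => (∏ j, (if j = a then (if j ∈ A then (1 : ℝ) else 0)
        else (if j ∈ A then r else 1 - r))) * φ A.card) fun T => by simp [e]
  have hp : (univ : Finset (Finset (Fin (n + 1)))) = (insert a (univ.erase a)).powerset := by
    rw [insert_erase (mem_univ a), powerset_univ]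
  rw [h1, hp, sum_powerset_insert (notMem_erase _ _)]
  have hz : ∀ A ∈ (univ.erase a).powerset, (∏ j, (if j = a then (if j ∈ A then (1 : ℝ) else 0)
        else (if j ∈ A then r else 1 - r))) * φ A.card = 0 := fun A hA => by
    have : a ∉ A := fun h => notMem_erase _ _ (mem_powerset.1 hA h)
    rw [prod_eq_zero (mem_univ a) (by simp [this]), zero_mul]
  have hc : (univ.erase a).card = n := by simp
  have hn : ∀ A ∈ (univ.erase a).powerset,
      (∏ j, (if j = a then (if j ∈ insert a A then (1 : ℝ) else 0)
        else (if j ∈ insert a A then r else 1 - r))) * φ (insert a A).card =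
      r ^ A.card * (1 - r) ^ (n - A.card) * φ (A.card + 1) := fun A hA => by
    have hsub := mem_powerset.1 hA
    have : a ∉ A := fun h => notMem_erase _ _ (hsub h)
    rw [card_insert_of_notMem this, ← mul_prod_erase univ _ (mem_univ a)]
    congr 1
    have h2 : ∀ j ∈ univ.erase a, (if j = a then (if j ∈ insert a A then (1 : ℝ) else 0)
        else (if j ∈ insert a A then r else 1 - r)) = if j ∈ A then r else 1 - r := fun j hj => by
      have := (mem_erase.1 hj).1
      simp [this]
    rw [prod_congr rfl h2, prod_ite, prod_const, prod_const, filter_mem_eq_inter,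
      inter_eq_right.2 hsub, filter_notMem_eq_sdiff, card_sdiff_of_subset hsub, hc]
    simp
  rw [sum_eq_zero hz, zero_add, sum_congr rfl hn,
    sum_powerset_apply_card (fun k => r ^ k * (1 - r) ^ (n - k) * φ (k + 1)), hc]
  simp only [nsmul_eq_mul]

end BinomialMoments

/-! ### Quartic bound for the moment function -/

theorem hasDerivAt_one_add_rpow_mul_one_sub_rpow (p q : ℝ) {x : ℝ} (hx : |x| < 1) :
    HasDerivAt (fun u : ℝ => (1 + u) ^ p * (1 - u) ^ q)
      (p * ((1 + x) ^ (p - 1) * (1 - x) ^ q) - q * ((1 + x) ^ p * (1 - x) ^ (q - 1))) x := by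
  obtain ⟨h1, h2⟩ := abs_lt.1 hx
  have ha := ((hasDerivAt_id x).const_add 1).rpow_const (p := p) (Or.inl (by simp; linarith))
  have hb := ((hasDerivAt_id x).const_sub 1).rpow_const (p := q) (Or.inl (by simp; linarith))
  exact (ha.mul hb).congr_deriv (by simp only [id]; ring)

/-- A quartic upper bound on `[-c, c]` whose quadratic coefficient is as close to the Taylor
coefficient as needed. -/
theorem exists_quartic_bound {α c : ℝ} (hα : 1 < α) (hc0 : 0 ≤ c) (hc : c < 1) :
    ∃ A B K : ℝ, 0 ≤ B ∧ 0 ≤ K ∧ B * c ^ 2 < 2 * α * (α - 1) ∧ ∀ u : ℝ, |u| ≤ c →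
      (1 - u) * ((1 + u) / (1 - u)) ^ α ≤ 1 + A * u + B * u ^ 2 + K * u ^ 4 := by
  have hD : 0 < 2 * α * (α - 1) := by nlinarith
  have hc2 : 0 < 1 - c ^ 2 := by nlinarith
  -- With `D = 2 * α * (α - 1)` the Taylor coefficient, `B > D` but `B * c ^ 2 = D * (1 - (1 - c ^
  -- 2) ^ 2) < D`.
  set B := 2 * α * (α - 1) * (2 - c ^ 2) with hB
  have hB0 : 2 * α * (α - 1) < B := by rw [hB]; nlinarith
  set A := 2 * α - 1 with hA
  have hform : ∀ u : ℝ, |u| < 1 →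
      (1 - u) * ((1 + u) / (1 - u)) ^ α = (1 + u) ^ α * (1 - u) ^ (1 - α) := fun u hu => by
    obtain ⟨h1, h2⟩ := abs_lt.1 hu
    rw [Real.div_rpow (by linarith) (by linarith), Real.rpow_sub (by linarith), Real.rpow_one]
    ring
  set h : ℝ → ℝ := fun u => (1 + u) ^ α * (1 - u) ^ (1 - α) - (1 + A * u + B * u ^ 2) with hh
  have hquad : ∀ x : ℝ, HasDerivAt (fun u : ℝ => 1 + A * u + B * u ^ 2) (A + 2 * B * x) x := by
    intro x
    have := (((hasDerivAt_id x).const_mul A).const_add 1).add (((hasDerivAt_id x).pow 2).const_mul B)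
    exact this.congr_deriv (by simp; ring)
  have hd : ∀ x, |x| < 1 → HasDerivAt h (α * ((1 + x) ^ (α - 1) * (1 - x) ^ (1 - α))
      - (1 - α) * ((1 + x) ^ α * (1 - x) ^ (1 - α - 1)) - (A + 2 * B * x)) x := fun x hx =>
    (hasDerivAt_one_add_rpow_mul_one_sub_rpow α (1 - α) hx).sub (hquad x)
  have hd0 : deriv h 0 = 0 := by
    rw [(hd 0 (by simp)).deriv]
    simp [hA]; ring
  have hdd : HasDerivAt (deriv h) (4 * α * (α - 1) - 2 * B) 0 := by
    have hev : deriv h =ᶠ[nhds 0] fun x => α * ((1 + x) ^ (α - 1) * (1 - x) ^ (1 - α))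
        - (1 - α) * ((1 + x) ^ α * (1 - x) ^ (1 - α - 1)) - (A + 2 * B * x) := by
      filter_upwards [Metric.ball_mem_nhds (0 : ℝ) one_pos] with x hx
      exact (hd x (by simpa using hx)).deriv
    refine HasDerivAt.congr_of_eventuallyEq ?_ hev
    have h1 := (hasDerivAt_one_add_rpow_mul_one_sub_rpow (α - 1) (1 - α)
      (x := 0) (by simp)).const_mul α
    have h2 := (hasDerivAt_one_add_rpow_mul_one_sub_rpow α (1 - α - 1)
      (x := 0) (by simp)).const_mul (1 - α)
    have h3 := ((hasDerivAt_id (0 : ℝ)).const_mul (2 * B)).const_add A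
    exact ((h1.sub h2).sub h3).congr_deriv (by simp; ring)
  -- As `B` exceeds the Taylor coefficient, `h` has a strictly negative second derivative at `0`, so
  -- `h ≤ h 0 = 0` nearby. Away from `0`, compactness bounds `h` and the `u ^ 4` term takes over.
  have hmax := isLocalMax_of_deriv_deriv_neg (f := h) (x₀ := 0)
    (by rw [hdd.deriv]; linarith) hd0 (hd 0 (by simp)).continuousAt
  obtain ⟨η, hη, hloc⟩ := Metric.eventually_nhds_iff.1 hmax
  have hcont : ContinuousOn h (Set.Icc (-c) c) := fun x hx =>
    (hd x (lt_of_le_of_lt (abs_le.2 hx) hc)).continuousAt.continuousWithinAt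
  obtain ⟨C, hC⟩ := isCompact_Icc.exists_bound_of_continuousOn hcont
  have hC0 : 0 ≤ C := (norm_nonneg _).trans (hC 0 ⟨by linarith, hc0⟩)
  refine ⟨A, B, C / η ^ 4, by linarith, by positivity, by rw [hB]; nlinarith, fun u hu => ?_⟩
  rw [hform u (hu.trans_lt hc)]
  have hK : h u ≤ C / η ^ 4 * u ^ 4 := by
    by_cases hs : |u| < η
    · have h0 : h u ≤ h 0 := hloc (by simpa using hs)
      have : h 0 = 0 := by simp [hh]
      rw [this] at h0
      exact h0.trans (by positivity)
    · push Not at hs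
      calc h u ≤ C := (le_abs_self _).trans (hC u (abs_le.1 hu))
        _ ≤ C / η ^ 4 * u ^ 4 := by
          rw [div_mul_eq_mul_div, le_div_iff₀ (by positivity)]
          have : η ^ 4 ≤ |u| ^ 4 := pow_le_pow_left₀ hη.le hs 4
          rw [Even.pow_abs (by decide)] at this
          gcongr
  simp only [hh] at hK
  linarith

/-! ### Averages over marks and signs -/

noncomputable section

/-- The average sign of the marked records. -/
def meanSign {n : ℕ} (T s : Fin n → Bool) : ℝ :=
  ((Finset.univ.filter fun j => T j).card : ℝ)⁻¹ * ∑ j with T j, boolSign (s j)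

theorem abs_meanSign_le_one {n : ℕ} (T s : Fin n → Bool) : |meanSign T s| ≤ 1 := by
  rw [meanSign, abs_mul, abs_of_nonneg (by positivity : (0 : ℝ) ≤
    ((Finset.univ.filter fun j => T j).card : ℝ)⁻¹)]
  exact inv_mul_le_one_of_le₀ (abs_sum_boolSign_le _ _) (by positivity)

theorem abs_mul_meanSign_le {n : ℕ} (d : ℝ) (T s : Fin n → Bool) : |d * meanSign T s| ≤ |d| := by
  rw [abs_mul]
  exact mul_le_of_le_one_right (abs_nonneg _) (abs_meanSign_le_one T s)

/-- The probability of the mark `t` of record `j` when the record `a` is always marked and the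
others are marked with probability `r`. -/
def markProb {n : ℕ} (a : Fin n) (r : ℝ) (j : Fin n) (t : Bool) : ℝ :=
  if j = a then (if t then 1 else 0) else (if t then r else 1 - r)

theorem markProb_nonneg {n : ℕ} (a : Fin n) {r : ℝ} (hr : 0 ≤ r) (hr1 : r ≤ 1) (j : Fin n)
    (t : Bool) : 0 ≤ markProb a r j t := by
  rw [markProb]
  split_ifs <;> linarith

/-- The number of marks is one plus a binomial variable, so both inverse moments apply. -/
theorem sum_markProb_mul_le {n : ℕ} (a : Fin (n + 1)) {r : ℝ} (hr : 0 < r) (hr1 : r ≤ 1)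
    {b k : ℝ} (hb : 0 ≤ b) (hk : 0 ≤ k) :
    ∑ T : Fin (n + 1) → Bool, (∏ j, markProb a r j (T j)) *
      (1 + b * ((Finset.univ.filter fun j => T j).card : ℝ)⁻¹ +
        k * (((Finset.univ.filter fun j => T j).card : ℝ) ^ 2)⁻¹) ≤
      1 + b * ((n + 1) * r)⁻¹ + k * (2 * (((n + 1) * r)⁻¹) ^ 2) := by
  simp only [markProb]
  rw [sum_prod_mark_eq a r (fun m => 1 + b * (m : ℝ)⁻¹ + k * ((m : ℝ) ^ 2)⁻¹)]
  have h0 : ∑ i ∈ Finset.range (n + 1), (n.choose i : ℝ) * (r ^ i * (1 - r) ^ (n - i)) = 1 := by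
    have := add_pow r (1 - r) n
    rw [add_sub_cancel, one_pow] at this
    exact (Finset.sum_congr rfl fun i _ => by ring).trans this.symm
  have h1 := mul_le_mul_of_nonneg_left (sum_choose_mul_inv_succ_le hr hr1 n) hb
  have h2 := mul_le_mul_of_nonneg_left (sum_choose_mul_inv_succ_sq_le hr hr1 n) hk
  refine le_trans (le_of_eq ?_) (add_le_add (add_le_add h0.le h1) h2)
  rw [Finset.mul_sum, Finset.mul_sum, ← Finset.sum_add_distrib, ← Finset.sum_add_distrib]
  refine Finset.sum_congr rfl fun i _ => ?_
  push_cast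
  ring

/-- The expectation over independent signs of a function with a quartic upper bound. -/
theorem sum_signs_le {n : ℕ} (T : Fin n → Bool) {f : ℝ → ℝ} {c A B K : ℝ} (hc : 0 ≤ c)
    (hK : 0 ≤ K) (hf : ∀ u : ℝ, |u| ≤ c → f u ≤ 1 + A * u + B * u ^ 2 + K * u ^ 4) {a : Fin n}
    (ha : T a) :
    ∑ s : Fin n → Bool, 2⁻¹ ^ n * f (c * meanSign T s) ≤
      1 + B * c ^ 2 * ((Finset.univ.filter fun j => T j).card : ℝ)⁻¹ +
        3 * K * c ^ 4 * (((Finset.univ.filter fun j => T j).card : ℝ) ^ 2)⁻¹ := by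
  set M := Finset.univ.filter fun j => T j with hM
  have hm : (0 : ℝ) < M.card := by
    exact_mod_cast Finset.card_pos.2 ⟨a, by simp [hM, ha]⟩
  set m : ℝ := (M.card : ℝ) with hm'
  have h1 := sum_sum_boolSign M
  have h2 := sum_sum_boolSign_sq M
  have h4 := sum_sum_boolSign_pow_four_le M
  rw [Fintype.card_fin, ← hm'] at h2 h4
  rw [← Finset.mul_sum]
  have hle : ∑ s : Fin n → Bool, f (c * meanSign T s) ≤ 2 ^ n + A * c * m⁻¹ * 0
      + B * c ^ 2 * (m⁻¹) ^ 2 * (2 ^ n * m) + K * c ^ 4 * (m⁻¹) ^ 4 * (2 ^ n * (3 * m ^ 2)) := by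
    calc _ ≤ ∑ s : Fin n → Bool, (1 + A * (c * meanSign T s) + B * (c * meanSign T s) ^ 2
          + K * (c * meanSign T s) ^ 4) := Finset.sum_le_sum fun s _ => hf _ <| by
            simpa [abs_of_nonneg hc] using abs_mul_meanSign_le c T s
      _ = 2 ^ n + A * c * m⁻¹ * ∑ s : Fin n → Bool, ∑ j ∈ M, boolSign (s j)
          + B * c ^ 2 * (m⁻¹) ^ 2 * ∑ s : Fin n → Bool, (∑ j ∈ M, boolSign (s j)) ^ 2
          + K * c ^ 4 * (m⁻¹) ^ 4 * ∑ s : Fin n → Bool, (∑ j ∈ M, boolSign (s j)) ^ 4 := by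
        have : (2 : ℝ) ^ n = ∑ s : Fin n → Bool, 1 := by simp
        rw [this]
        simp only [Finset.mul_sum, ← Finset.sum_add_distrib]
        refine Finset.sum_congr rfl fun s _ => ?_
        simp only [meanSign, ← hM, ← hm', ← Finset.mul_sum]
        ring
      _ ≤ _ := by
        rw [h1, h2]
        gcongr
  calc _ ≤ _ := mul_le_mul_of_nonneg_left hle (by positivity)
    _ = _ := by
      rw [inv_pow]
      field_simp
      ring

/-! ### Shuffled laws as mixtures weighted by the mean sign -/

section Expansion

variable {n : ℕ} {D : Type*} {S : Fin n → Type*} [∀ i, MeasurableSpace (S i)]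
  (G : ∀ i : Fin n, Bool → Kernel (∀ j : Fin i, S (j.castLE i.isLt.le)) (S i))
  (L : ∀ i : Fin n, Fin n → Kernel (∀ j : Fin i, S (j.castLE i.isLt.le)) (S i))

/-- The weight of a set of marks, for each permutation and each choice of signs. -/
def markWeight (a : Fin n) (r : ℝ) (T : Fin n → Bool) : ℝ≥0∞ :=
  (n.factorial : ℝ≥0∞)⁻¹ * (∏ j, ENNReal.ofReal (markProb a r j (T j))) * 2⁻¹ ^ n

theorem markWeight_eq_zero (a : Fin n) (r : ℝ) {T : Fin n → Bool} (ha : ¬ T a) :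
    markWeight a r T = 0 := by
  rw [markWeight, Finset.prod_eq_zero (Finset.mem_univ a) (by simp [markProb, ha])]
  simp

theorem markWeight_ne_top (a : Fin n) (r : ℝ) (T : Fin n → Bool) : markWeight a r T ≠ ⊤ := by
  have h1 : (n.factorial : ℝ≥0∞) ≠ 0 := by exact_mod_cast n.factorial_ne_zero
  have h2 : ∏ j, ENNReal.ofReal (markProb a r j (T j)) ≠ ⊤ :=
    ENNReal.prod_ne_top fun j _ => ENNReal.ofReal_ne_top
  rw [markWeight]
  finiteness

theorem inv_card_mul_sum_ofReal_boolSign {T : Fin n → Bool} {a : Fin n} (ha : T a)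
    (s : Fin n → Bool) {d : ℝ} (hd : |d| ≤ 1) :
    ((Finset.univ.filter fun j => T j).card : ℝ≥0∞)⁻¹ *
        ∑ j with T j, ENNReal.ofReal (1 + d * boolSign (s j)) =
      ENNReal.ofReal (1 + d * meanSign T s) := by
  have hm : (0 : ℝ) < (Finset.univ.filter fun j => T j).card := by
    exact_mod_cast Finset.card_pos.2 ⟨a, by simp [ha]⟩
  obtain ⟨h1, h2⟩ := abs_le.1 hd
  rw [← ENNReal.ofReal_sum_of_nonneg fun j _ => by
      cases s j <;> simp [boolSign] <;> linarith,
    ← ENNReal.ofReal_natCast, ← ENNReal.ofReal_inv_of_pos hm,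
    ← ENNReal.ofReal_mul (by positivity)]
  congr 1
  rw [Finset.sum_add_distrib, ← Finset.mul_sum, meanSign, Finset.sum_const, nsmul_one, mul_add,
    inv_mul_cancel₀ hm.ne']
  ring

/-- Serves both datasets, with `d = c` and `d = -c`: the component laws are the same and only the
weights differ. -/
theorem AdaptiveProcess.shuffledLaw_eq_sum_meanSign [∀ i t, IsMarkovKernel (G i t)]
    [∀ i j, IsMarkovKernel (L i j)] (R : AdaptiveProcess n D S) (X : Fin n → D) (a : Fin n)
    {r d : ℝ} (hr : 0 ≤ r) (hr1 : r ≤ 1) (hd : |d| ≤ 1)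
    (ha : ∀ i z s, MeasurableSet s → (R.randomizer i (X a) z).real s =
      2⁻¹ * ((1 + d) * (G i true z).real s + (1 - d) * (G i false z).real s))
    (hj : ∀ i j z s, j ≠ a → MeasurableSet s → (R.randomizer i (X j) z).real s =
      r * 2⁻¹ * ((G i true z).real s + (G i false z).real s) + (1 - r) * (L i j z).real s) :
    R.shuffledLaw X = ∑ ω : (Fin n → Bool) × Equiv.Perm (Fin n) × (Fin n → Bool),
      (markWeight a r ω.1 * ENNReal.ofReal (1 + d * meanSign ω.1 ω.2.2)) •
        cloneLaw G L ω.2.1 ω.1 ω.2.2 := by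
  have hM := R.isMarkov
  obtain ⟨hd1, hd2⟩ := abs_le.1 hd
  have hw : ∀ j (t : Bool × Bool), 0 ≤ markProb a r j t.1 * 2⁻¹ *
      (if j = a then 1 + d * boolSign t.2 else 1) := fun j t => by
    have := markProb_nonneg a hr hr1 j t.1
    have : 0 ≤ 1 + d * boolSign t.2 := by cases t.2 <;> simp [boolSign] <;> linarith
    split_ifs <;> positivity
  have hR : ∀ i j z, R.randomizer i (X j) z = ∑ t : Bool × Bool,
      (ENNReal.ofReal (markProb a r j t.1) * 2⁻¹ *
        (if j = a then ENNReal.ofReal (1 + d * boolSign t.2) else 1)) •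
        (if t.1 then G i t.2 else L i j) z := by
    intro i j z
    have hmk : ∀ t : Bool × Bool, IsMarkovKernel (if t.1 then G i t.2 else L i j) := fun t => by
      split_ifs <;> infer_instance
    ext s hs
    have hterm : ∀ t : Bool × Bool, (ENNReal.ofReal (markProb a r j t.1) * 2⁻¹ *
        (if j = a then ENNReal.ofReal (1 + d * boolSign t.2) else 1)) *
        (if t.1 then G i t.2 else L i j) z s = ENNReal.ofReal ((markProb a r j t.1 * 2⁻¹ *
        (if j = a then 1 + d * boolSign t.2 else 1)) *
          ((if t.1 then G i t.2 else L i j) z).real s) := fun t => by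
      rw [ENNReal.ofReal_mul (hw j t), ofReal_measureReal,
        ENNReal.ofReal_mul (mul_nonneg (markProb_nonneg a hr hr1 j t.1) (by norm_num)),
        ENNReal.ofReal_mul (markProb_nonneg a hr hr1 j t.1),
        ENNReal.ofReal_inv_of_pos two_pos, ENNReal.ofReal_ofNat, apply_ite ENNReal.ofReal,
        ENNReal.ofReal_one]
    simp only [Measure.coe_finsetSum, Finset.sum_apply, Measure.smul_apply, smul_eq_mul, hterm]
    rw [← ENNReal.ofReal_sum_of_nonneg fun t _ => mul_nonneg (hw j t) measureReal_nonneg,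
      ← ofReal_measureReal]
    congr 1
    rw [Fintype.sum_prod_type]
    simp only [Fintype.sum_bool]
    by_cases hja : j = a
    · subst hja
      rw [ha i z s hs]
      simp [markProb, boolSign]
      ring
    · rw [hj i j z s hja hs]
      simp [markProb, hja]
      ring
  rw [R.shuffledLaw_eq_sum_cloneLaw G L X a
    (fun j t => ENNReal.ofReal (markProb a r j t))
    (fun t => ENNReal.ofReal (1 + d * boolSign t)) hR, Fintype.sum_prod_type]
  refine Finset.sum_congr rfl fun T _ => ?_
  rw [Fintype.sum_prod_type]
  change markWeight a r T • _ = _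
  by_cases hT : T a
  · rw [sum_smul_cloneLaw_eq_average G L T hT fun t => ENNReal.ofReal (1 + d * boolSign t)]
    simp only [inv_card_mul_sum_ofReal_boolSign hT _ hd, Finset.smul_sum, smul_smul]
  · simp [markWeight_eq_zero a r hT]

end Expansion

/-! ### Rényi moment of the shuffled law -/

section Bound

variable {n : ℕ} {D : Type*} {S : Fin n → Type*} [∀ i, MeasurableSpace (S i)]

theorem AdaptiveProcess.IsLocallyDP.lintegral_rnDeriv_shuffledLaw_le {R : AdaptiveProcess n D S}
    {ε α : ℝ} (hR : R.IsLocallyDP ε) (hε : 0 ≤ ε) (hα : 1 ≤ α) {X Y : Fin n → D} {a : Fin n}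
    (hXY : ∀ j, j ≠ a → X j = Y j) :
    R.shuffledLaw X ≪ R.shuffledLaw Y ∧
    ∫⁻ ω, ((R.shuffledLaw X).rnDeriv (R.shuffledLaw Y) ω) ^ α ∂(R.shuffledLaw Y) ≤
      ENNReal.ofReal (∑ T : Fin n → Bool, (∏ j, markProb a (Real.exp ε)⁻¹ j (T j)) *
        ∑ s : Fin n → Bool, 2⁻¹ ^ n *
          ((1 - (Real.exp ε - 1) / (Real.exp ε + 1) * meanSign T s) *
          ((1 + (Real.exp ε - 1) / (Real.exp ε + 1) * meanSign T s) /
            (1 - (Real.exp ε - 1) / (Real.exp ε + 1) * meanSign T s)) ^ α)) := by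
  have hM := R.isMarkov
  have hE : 1 ≤ Real.exp ε := Real.one_le_exp hε
  have hr : 0 ≤ (Real.exp ε)⁻¹ := by positivity
  have hr1 : (Real.exp ε)⁻¹ ≤ 1 := inv_le_one_of_one_le₀ hE
  set r := (Real.exp ε)⁻¹ with hr'
  choose G L hG hL hdec using fun i => exists_clone_decomposition (fun x => R.randomizer i x) hε
    (fun z => hR i z) (X a) (Y a)
  set c := (Real.exp ε - 1) / (Real.exp ε + 1) with hc
  have hc0 : 0 ≤ c := div_nonneg (by linarith) (by linarith)
  have hc1 : c < 1 := by rw [hc, div_lt_one (by linarith)]; linarith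
  have hu : ∀ T s : Fin n → Bool, 0 < 1 - c * meanSign T s ∧ 0 < 1 + c * meanSign T s := by
    intro T s
    have := abs_le.1 (abs_mul_meanSign_le c T s)
    rw [abs_of_nonneg hc0] at this
    constructor <;> linarith
  have hP := R.shuffledLaw_eq_sum_meanSign G (fun i j => L i (X j)) X a hr hr1 (d := c)
    (by rw [abs_of_nonneg hc0]; exact hc1.le) (fun i z s hs => (hdec i z s hs).1)
    (fun i j z s _ hs => (hdec i z s hs).2.2 (X j))
  have hQ := R.shuffledLaw_eq_sum_meanSign G (fun i j => L i (X j)) Y a hr hr1 (d := -c)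
    (by rw [abs_neg, abs_of_nonneg hc0]; exact hc1.le)
    (fun i z s hs => by rw [(hdec i z s hs).2.1]; ring)
    (fun i j z s hj hs => by rw [← hXY j hj]; exact (hdec i z s hs).2.2 (X j))
  simp only [neg_mul, ← sub_eq_add_neg] at hQ
  set M := cloneLaw G fun i j => L i (X j)
  have hprob : ∀ π T s, IsProbabilityMeasure (M π T s) :=
    isProbabilityMeasure_cloneLaw G fun i j => L i (X j)
  let N : (Fin n → Bool) × Equiv.Perm (Fin n) × (Fin n → Bool) → Measure (∀ i, S i) := fun ω =>
    (markWeight a r ω.1 * ENNReal.ofReal (1 - c * meanSign ω.1 ω.2.2)) • M ω.2.1 ω.1 ω.2.2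
  have hN : ∀ ω, IsFiniteMeasure (N ω) := fun ω =>
    Measure.smul_finite _ (ENNReal.mul_ne_top (markWeight_ne_top a r _) ENNReal.ofReal_ne_top)
  let ρ : (Fin n → Bool) × Equiv.Perm (Fin n) × (Fin n → Bool) → ℝ≥0∞ := fun ω =>
    ENNReal.ofReal ((1 + c * meanSign ω.1 ω.2.2) / (1 - c * meanSign ω.1 ω.2.2))
  have hP' : R.shuffledLaw X = ∑ ω, ρ ω • N ω := by
    rw [hP]
    refine Finset.sum_congr rfl fun ω _ => ?_
    obtain ⟨h1, h2⟩ := hu ω.1 ω.2.2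
    rw [smul_smul, mul_left_comm, ← ENNReal.ofReal_mul (by positivity), div_mul_cancel₀ _ h1.ne']
  rw [hP', hQ]
  refine ⟨(lintegral_rnDeriv_rpow_sum_le N ρ hα).1,
    (lintegral_rnDeriv_rpow_sum_le N ρ hα).2.trans (le_of_eq ?_)⟩
  have hterm : ∀ ω, ρ ω ^ α * N ω Set.univ = markWeight a r ω.1 * ENNReal.ofReal
      ((1 - c * meanSign ω.1 ω.2.2) *
        ((1 + c * meanSign ω.1 ω.2.2) / (1 - c * meanSign ω.1 ω.2.2)) ^ α) := fun ω => by
    obtain ⟨h1, h2⟩ := hu ω.1 ω.2.2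
    simp only [N, ρ, Measure.smul_apply, measure_univ, smul_eq_mul, mul_one]
    rw [ENNReal.ofReal_rpow_of_pos (by positivity), ENNReal.ofReal_mul h1.le]
    ring
  have hf : ∀ T s : Fin n → Bool, 0 ≤ (1 - c * meanSign T s) *
      ((1 + c * meanSign T s) / (1 - c * meanSign T s)) ^ α := fun T s => by
    obtain ⟨h1, h2⟩ := hu T s
    positivity
  have hq : ∀ T : Fin n → Bool, 0 ≤ ∏ j, markProb a r j (T j) := fun T =>
    Finset.prod_nonneg fun j _ => markProb_nonneg a hr hr1 j _
  simp only [hterm]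
  rw [ENNReal.ofReal_sum_of_nonneg fun T _ => mul_nonneg (hq T)
      (Finset.sum_nonneg fun s _ => mul_nonneg (by positivity) (hf T s)), Fintype.sum_prod_type]
  refine Finset.sum_congr rfl fun T _ => ?_
  rw [Fintype.sum_prod_type]
  -- The terms no longer depend on the permutation; their number `n!` cancels the normalization.
  simp only [Finset.sum_const, Finset.card_univ, Fintype.card_perm, Fintype.card_fin]
  rw [← Finset.mul_sum, ENNReal.ofReal_mul (hq T), ← Finset.mul_sum,
    ENNReal.ofReal_mul (by positivity), ENNReal.ofReal_sum_of_nonneg fun s _ => hf T s,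
    ENNReal.ofReal_pow (by norm_num), ENNReal.ofReal_inv_of_pos two_pos, ENNReal.ofReal_ofNat,
    ENNReal.ofReal_prod_of_nonneg fun j _ => markProb_nonneg a hr hr1 j _, markWeight,
    nsmul_eq_mul]
  have h1 : (n.factorial : ℝ≥0∞) ≠ 0 := by exact_mod_cast n.factorial_ne_zero
  simp only [← mul_assoc]
  rw [ENNReal.mul_inv_cancel h1 (by finiteness), one_mul]

end Bound
end

/-! ### Choice of the threshold and conclusion -/

theorem corollary2 (ε₀ α : ℝ) (hε₀ : 0 ≤ ε₀) (hα : 2 ≤ α) :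
    ∀ᶠ n : ℕ in atTop,
      ∀ (D : Type*) (S : Fin n → Type*) [∀ i, MeasurableSpace (S i)]
        (R : AdaptiveProcess n D S), R.IsLocallyDP ε₀ →
          IsRDP α (2 * Real.exp ε₀ * α / ((n : ℝ) - 1)) R.shuffledLaw := by
  have hE : 1 ≤ Real.exp ε₀ := Real.one_le_exp hε₀
  set E := Real.exp ε₀ with hE'
  set c := (E - 1) / (E + 1) with hc
  have hc0 : 0 ≤ c := div_nonneg (by linarith) (by linarith)
  have hc1 : c < 1 := by rw [hc, div_lt_one (by linarith)]; linarith
  obtain ⟨A, B, K, hB, hK, hBc, hf⟩ := exists_quartic_bound (by linarith : 1 < α) hc0 hc1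
  -- Beyond this threshold the quartic contribution `6 * K * c ^ 4 * (E / n) ^ 2` fits into the gap
  -- left by `B * c ^ 2`. It involves only `ε₀` and `α`.
  obtain ⟨n₀, hn₀⟩ := exists_nat_gt (6 * K * c ^ 4 * E / (2 * α * (α - 1) - B * c ^ 2))
  filter_upwards [eventually_ge_atTop (n₀ + 2)] with n hn D S _ R hR X Y hXY
  obtain ⟨a, -, hXY⟩ := hXY
  obtain ⟨hac, hle⟩ := hR.lintegral_rnDeriv_shuffledLaw_le hε₀ (by linarith : 1 ≤ α) hXY
  refine renyiDivergence_le_of_lintegral_le (by linarith) hac (hle.trans ?_)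
  refine ENNReal.ofReal_le_ofReal ?_
  simp only [← hE', ← hc]
  have hr : 0 < E⁻¹ := by positivity
  have hr1 : E⁻¹ ≤ 1 := inv_le_one_of_one_le₀ hE
  have hT : ∀ T : Fin n → Bool, (∏ j, markProb a E⁻¹ j (T j)) *
      ∑ s : Fin n → Bool, 2⁻¹ ^ n * ((1 - c * meanSign T s) *
        ((1 + c * meanSign T s) / (1 - c * meanSign T s)) ^ α) ≤
      (∏ j, markProb a E⁻¹ j (T j)) *
        (1 + B * c ^ 2 * ((Finset.univ.filter fun j => T j).card : ℝ)⁻¹ +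
          3 * K * c ^ 4 * (((Finset.univ.filter fun j => T j).card : ℝ) ^ 2)⁻¹) := fun T => by
    by_cases ha : T a
    · exact mul_le_mul_of_nonneg_left (sum_signs_le T hc0 hK hf ha)
        (Finset.prod_nonneg fun j _ => markProb_nonneg a hr.le hr1 j _)
    · rw [Finset.prod_eq_zero (Finset.mem_univ a) (by simp [markProb, ha]), zero_mul, zero_mul]
  refine (Finset.sum_le_sum fun T _ => hT T).trans ?_
  obtain ⟨N, rfl⟩ : ∃ N, n = N + 1 := ⟨n - 1, by omega⟩
  refine (sum_markProb_mul_le a hr hr1 (by positivity) (by positivity)).trans ?_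
  have hN : (n₀ : ℝ) + 1 ≤ N := by exact_mod_cast (by omega : n₀ + 1 ≤ N)
  have hn₀0 : (0 : ℝ) ≤ n₀ := n₀.cast_nonneg
  have hgap : 0 < 2 * α * (α - 1) - B * c ^ 2 := by linarith
  rw [div_lt_iff₀ hgap] at hn₀
  refine le_trans ?_ (Real.add_one_le_exp _)
  have hx : ((N + 1 : ℝ) * E⁻¹)⁻¹ = E / (N + 1) := by
    rw [mul_inv, inv_inv, div_eq_inv_mul]
  have hsmall : 6 * K * c ^ 4 * (E / (N + 1)) ≤ 2 * α * (α - 1) - B * c ^ 2 := by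
    rw [← mul_div_assoc, div_le_iff₀ (by linarith)]
    nlinarith
  have hx0 : 0 < E / ((N : ℝ) + 1) := div_pos (by linarith) (by linarith)
  rw [hx]
  have h1 : B * c ^ 2 * (E / (N + 1)) + 3 * K * c ^ 4 * (2 * (E / (N + 1)) ^ 2) ≤
      2 * α * (α - 1) * (E / (N + 1)) := by nlinarith
  -- The argument yields the rate `1 / n`; it is only here weakened to `1 / (n - 1)`.
  have h2 : E / ((N : ℝ) + 1) ≤ E / N := by gcongr <;> linarith
  have h3 : (α - 1) * (2 * E * α / (((N + 1 : ℕ) : ℝ) - 1)) = 2 * α * (α - 1) * (E / N) := by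
    push_cast
    rw [add_sub_cancel_right]
    ring
  rw [h3]
  have h4 := mul_le_mul_of_nonneg_left h2 (by nlinarith : 0 ≤ 2 * α * (α - 1))
  linarith
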